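/- Let $H$ be a group, $G$ a subgroup of $H$ and $X\subseteq H$ a subset with $1\in X$. Let $\mathcal P$ be the set of all intersections of finite nonempty families of sets of the form $gX$ with $g\in G$ and $1\in gX$. Let $C$ be the set of triples $(a,P,b)$ with $a,b\in G$, $P\in\mathcal P$ and $P\subseteq aX\cap bX$, with the partial product $(a,P,b)(b,Q,c)=(a,P\cap Q,c)$ (other products being undefined). The group $G$ acts partially on $C$ by $g\cdot(a,P,b)=(ga,gP,gb)$, defined when $gP\in\mathcal P$. Let $\Gamma(X,G,H)=C/G$ be the set of classes $[x]$, where $x\sim y$ if and only if $g\cdot x=y$ for some $g\in G$, with the partial product $[x][y]=[(g\cdot x)(h\cdot y)]$, defined if there are $g,h\in G$ for which $(g\cdot x)(h\cdot y)$ is defined in $C$. The universal group of a set $S$ with a partial binary operation $\circ$ is the group with generating set $S$ and relations $s\cdot t=s\circ t$ for all $s,t\in S$ such that $s\circ t$ is defined. **Theorem.** Let $H$ be a connected and simply connected topological group and let $G$ be a dense subgroup of $H$. Let $1\in V\subseteq X\subseteq H$, where $V$ is open in $H$, path-connected, and a $G$-covering, that is, $H=\bigcup_{g\in G}gV$. Suppose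 that $X\subseteq\bigcup_{s\in V}Vs^{-1}$. Then the universal group of $\Gamma(X,G,H)$ is isomorphic to $G$. -/

import Mathlib

open scoped Pointwise

/-- A set with a partial binary operation, given by its graph: `IsMul s t u` says that the product
of `s` and `t` is defined and equal to `u`. -/
class PartialMul (S : Type*) where
  IsMul : S → S → S → Prop
  unique : ∀ {s t u v : S}, IsMul s t u → IsMul s t v → u = v

/-- The defining relators `s · t · (s ∘ t)⁻¹`, one for each defined product `s ∘ t`. -/
def universalRels (S : Type*) [PartialMul S] : Set (FreeGroup S) :=
  {r | ∃ s t u : S, PartialMul.IsMul s t u ∧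
    r = FreeGroup.of s * FreeGroup.of t * (FreeGroup.of u)⁻¹}

/-- The universal group of a set with a partial binary operation: the free group on `S` modulo
`s · t = s ∘ t` for all `s, t` such that `s ∘ t` is defined. -/
abbrev UniversalGroup (S : Type*) [PartialMul S] : Type _ :=
  PresentedGroup (universalRels S)

/-- `V ⊆ M` is a `G`-covering if the translates `gV`, `g ∈ G`, cover `M`. -/
def IsGCovering (G : Type*) {M : Type*} [Group G] [MulAction G M] (V : Set M) : Prop :=
  (⋃ g : G, g • V) = Set.univ

namespace GammaSemigroup

/-- The translates `gX`, `g ∈ G`, that contain `1`. -/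
def translates {H : Type*} [Group H] (X : Set H) (G : Subgroup H) : Set (Set H) :=
  {A | (∃ g : G, A = g • X) ∧ (1 : H) ∈ A}

/-- The intersections of finite nonempty families of translates `gX ∋ 1`, `g ∈ G`. -/
def patterns {H : Type*} [Group H] (X : Set H) (G : Subgroup H) : Set (Set H) :=
  {P | ∃ F : Set (Set H), F.Finite ∧ F.Nonempty ∧ F ⊆ translates X G ∧ P = ⋂₀ F}

theorem inter_mem_patterns {H : Type*} [Group H] {X : Set H} {G : Subgroup H} {P Q : Set H}
    (hP : P ∈ patterns X G) (hQ : Q ∈ patterns X G) : P ∩ Q ∈ patterns X G := by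
  obtain ⟨F, hF, hFn, hFt, rfl⟩ := hP
  obtain ⟨F', hF', -, hFt', rfl⟩ := hQ
  exact ⟨F ∪ F', hF.union hF', hFn.inl, Set.union_subset hFt hFt', Set.sInter_union F F' |>.symm⟩

/-- The triples `(a, P, b)` with `a, b ∈ G`, `P` a pattern, `P ⊆ aX` and `P ⊆ bX`. -/
@[ext]
structure Triple {H : Type*} [Group H] (X : Set H) (G : Subgroup H) where
  left : G
  pattern : Set H
  right : G
  mem_patterns : pattern ∈ patterns X G
  subset_left : pattern ⊆ left • X
  subset_right : pattern ⊆ right • X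

/-- The product `(a, P, b)(b, Q, c) = (a, P ∩ Q, c)`. -/
def Triple.mul {H : Type*} [Group H] {X : Set H} {G : Subgroup H} (x y : Triple X G)
    (_h : x.right = y.left) : Triple X G where
  left := x.left
  pattern := x.pattern ∩ y.pattern
  right := y.right
  mem_patterns := inter_mem_patterns x.mem_patterns y.mem_patterns
  subset_left := Set.inter_subset_left.trans x.subset_left
  subset_right := Set.inter_subset_right.trans y.subset_right

/-- The partial action `g · (a, P, b) = (ga, gP, gb)`, defined if `gP` is a pattern. -/
def Triple.act {H : Type*} [Group H] {X : Set H} {G : Subgroup H} (g : G) (x : Triple X G)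
    (h : g • x.pattern ∈ patterns X G) : Triple X G where
  left := g * x.left
  pattern := g • x.pattern
  right := g * x.right
  mem_patterns := h
  subset_left := by
    rw [mul_smul]
    exact Set.smul_set_mono x.subset_left
  subset_right := by
    rw [mul_smul]
    exact Set.smul_set_mono x.subset_right

/-- Two triples are equivalent if some element of `G` takes the one to the other. -/
def orbitSetoid {H : Type*} [Group H] (X : Set H) (G : Subgroup H) : Setoid (Triple X G) where
  r x y := ∃ (g : G) (h : g • x.pattern ∈ patterns X G), x.act g h = y
  iseqv := by
    refine ⟨fun x => ⟨1, by simpa using x.mem_patterns, ?_⟩, ?_, ?_⟩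
    · ext1 <;> simp [Triple.act]
    · rintro x _ ⟨g, h, rfl⟩
      refine ⟨g⁻¹, by simpa [Triple.act] using x.mem_patterns, ?_⟩
      ext1 <;> simp [Triple.act]
    · rintro x _ _ ⟨g, h, rfl⟩ ⟨k, h', rfl⟩
      refine ⟨k * g, by simpa [Triple.act, mul_smul] using h', ?_⟩
      ext1 <;> simp [Triple.act, mul_smul, mul_assoc]

end GammaSemigroup

/-- The underlying set of the semigroup `Γ(X, G, H)`: the classes `[a, P, b]` of triples under the
partial action of `G`. -/
def Gamma {H : Type*} [Group H] (X : Set H) (G : Subgroup H) : Type _ :=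
  Quotient (GammaSemigroup.orbitSetoid X G)

/-- The class `[a, P, b]` of a triple. -/
def Gamma.mk {H : Type*} [Group H] {X : Set H} {G : Subgroup H}
    (x : GammaSemigroup.Triple X G) : Gamma X G :=
  Quotient.mk (GammaSemigroup.orbitSetoid X G) x

/-- The partial product of `Γ(X, G, H)`: the product of two classes is defined if they have
representatives whose product is defined, and it is then the class of that product. -/
instance Gamma.instPartialMul {H : Type*} [Group H] (X : Set H) (G : Subgroup H) :
    PartialMul (Gamma X G) where
  IsMul s t u := ∃ (x y : GammaSemigroup.Triple X G) (h : x.right = y.left),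
    Gamma.mk x = s ∧ Gamma.mk y = t ∧ Gamma.mk (x.mul y h) = u
  unique := by
    rintro s t u v ⟨x, y, h, rfl, rfl, rfl⟩ ⟨x', y', h', hx, hy, rfl⟩
    obtain ⟨g, hg, rfl⟩ := Quotient.exact hx.symm
    obtain ⟨k, hk, rfl⟩ := Quotient.exact hy.symm
    have hgk : g = k := by
      have h2 : g * x.right = k * y.left := h'
      rw [h] at h2
      exact mul_right_cancel h2
    subst hgk
    refine Quotient.sound ⟨g, ?_, ?_⟩
    · show g • (x.pattern ∩ y.pattern) ∈ _
      rw [Set.smul_set_inter]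
      exact GammaSemigroup.inter_mem_patterns hg hk
    · ext1
      · rfl
      · exact Set.smul_set_inter
      · rfl

/-!
Put `Y = X ∩ G`. In the universal group of `Γ(X, G, H)` every class `[a, P, a]` is idempotent, hence
trivial, so `[a, P, b]` depends only on `a⁻¹b`, which ranges over `Y / Y`. Thus `a⁻¹b ↦ [a, P, b]`
is a function `σ` on `Y / Y` with `σ(a / b) σ(b / c) = σ(a / c)`, and the theorem says that `σ` is
the restriction of a unique homomorphism on `G`.

By density `σ g σ h = σ (gh)` whenever `V ∩ gV ∩ ghV ≠ ∅`. By a theorem of Macbeath, such a `σ`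
agrees with a homomorphism `ψ` wherever `V ∩ gV ≠ ∅`: the elements `σ (g⁻¹h)` form a locally
constant cocycle on the cover of `H` by the sets `gV`, the bundle with discrete fibre glued from it
is a covering of a simply connected space, hence trivial, and two trivializations differ by a
constant. Finally `V ∩ gV ≠ ∅` means `g ∈ VV⁻¹`, so `ψ = σ` on `Y`, and therefore on `Y / Y`.
-/

section Covering

variable {E B F : Type*} [TopologicalSpace E] [TopologicalSpace B] [TopologicalSpace F] {p : E → B}

theorem exists_joined_of_isCoveringMap [PathConnectedSpace B] (cov : IsCoveringMap p) (e : E)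
    (x : B) : ∃ e' : E, p e' = x ∧ Joined e e' := by
  let γ := PathConnectedSpace.somePath (p e) x
  let e' := cov.monodromy (.mk γ) ⟨e, rfl⟩
  exact ⟨e', e'.2, ⟨(cov.liftPathQuotient (.mk γ) ⟨e, rfl⟩).out⟩⟩

theorem eq_of_joined_of_isCoveringMap [SimplyConnectedSpace B] (cov : IsCoveringMap p) {e e' : E}
    (h : Joined e e') (hp : p e = p e') : e = e' := by
  have hmon := cov.monodromy_eq_of_map_eq (γ := .refl (p e)) (ex := ⟨e, rfl⟩)
    (ey := ⟨e', hp.symm⟩) (.mk h.somePath) (Subsingleton.elim _ _)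
  rw [cov.monodromy_refl] at hmon
  exact congrArg Subtype.val hmon

theorem joined_trivialization_symm (τ : Bundle.Trivialization F p)
    (hτ : IsPathConnected τ.baseSet) (t : F) {x y : B} (hx : x ∈ τ.baseSet) (hy : y ∈ τ.baseSet) :
    Joined (τ.toOpenPartialHomeomorph.symm (x, t)) (τ.toOpenPartialHomeomorph.symm (y, t)) := by
  have hcont : ContinuousOn (fun z => τ.toOpenPartialHomeomorph.symm (z, t)) τ.baseSet :=
    τ.toOpenPartialHomeomorph.continuousOn_symm.comp (by fun_prop) fun z hz => τ.mem_target.mpr hz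
  exact ((hτ.image' hcont).joinedIn _ ⟨x, hx, rfl⟩ _ ⟨y, hy, rfl⟩).joined

theorem exists_forall_joined_trivialization_symm [PathConnectedSpace B] (cov : IsCoveringMap p)
    (e : E) (τ : Bundle.Trivialization F p) (hτ : IsPathConnected τ.baseSet) :
    ∃ t : F, ∀ x ∈ τ.baseSet, Joined e (τ.toOpenPartialHomeomorph.symm (x, t)) := by
  obtain ⟨x₀, hx₀⟩ := hτ.nonempty
  obtain ⟨e', rfl, he'⟩ := exists_joined_of_isCoveringMap cov e x₀
  refine ⟨(τ e').2, fun x hx => he'.trans ?_⟩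
  simpa only [τ.symm_apply_mk_proj (τ.mem_source.mpr hx₀)]
    using joined_trivialization_symm τ hτ (τ e').2 hx₀ hx

end Covering

section Cocycle

variable {ι B T : Type*} [Group T]

/-- A locally constant Čech 1-cocycle with values in `T` on the family of sets `W`: a constant
`φ i j` for each pair of indices, subject to the cocycle identity on nonempty triple overlaps. -/
def IsFlatCocycle (W : ι → Set B) (φ : ι → ι → T) : Prop :=
  ∀ ⦃i j k⦄, (W i ∩ W j ∩ W k).Nonempty → φ i j * φ j k = φ i k

/-- A trivialization of the cocycle `φ`: a locally constant 0-cochain `c` whose coboundary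
`(c i)⁻¹ * c j` is `φ i j` on nonempty overlaps. -/
def IsFlatTrivialization (W : ι → Set B) (φ : ι → ι → T) (c : ι → T) : Prop :=
  ∀ ⦃i j⦄, (W i ∩ W j).Nonempty → c i * φ i j = c j

variable [TopologicalSpace B] {W : ι → Set B} {φ : ι → ι → T}

/-- The bundle with discrete fibre `T` glued from the sets `W i × T` by right multiplication by
the `φ i j`. -/
noncomputable def IsFlatCocycle.fiberBundleCore [TopologicalSpace T] [DiscreteTopology T]
    (hφ : IsFlatCocycle W φ) (hWo : ∀ i, IsOpen (W i)) (hWc : ∀ x, ∃ i, x ∈ W i) :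
    FiberBundleCore ι B T where
  baseSet := W
  isOpen_baseSet := hWo
  indexAt x := (hWc x).choose
  mem_baseSet_at x := (hWc x).choose_spec
  coordChange i j _ t := t * φ i j
  coordChange_self i x hx t := by
    rw [mul_eq_left.mp (hφ ⟨x, ⟨hx, hx⟩, hx⟩), mul_one]
  continuousOn_coordChange i j :=
    ((continuous_of_discreteTopology (f := fun t : T => t * φ i j)).comp
      continuous_snd).continuousOn
  coordChange_comp i j k x hx t := by rw [mul_assoc, hφ ⟨x, hx⟩]

theorem IsFlatCocycle.exists_isFlatTrivialization [SimplyConnectedSpace B]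
    (hφ : IsFlatCocycle W φ) (hWo : ∀ i, IsOpen (W i)) (hWp : ∀ i, IsPathConnected (W i))
    (hWc : ∀ x, ∃ i, x ∈ W i) : ∃ c : ι → T, IsFlatTrivialization W φ c := by
  let _ : TopologicalSpace T := ⊥
  have : DiscreteTopology T := ⟨rfl⟩
  let Z := hφ.fiberBundleCore hWo hWc
  have cov : IsCoveringMap Z.proj := FiberBundle.isCoveringMap (F := T) (E := Z.Fiber)
  obtain ⟨b₀⟩ : Nonempty B := PathConnectedSpace.nonempty
  let e₀ : Z.TotalSpace := ⟨b₀, (1 : T)⟩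
  choose c hc using fun i =>
    exists_forall_joined_trivialization_symm cov e₀ (Z.localTriv i) (hWp i)
  refine ⟨c, fun i j ⟨x, hxi, hxj⟩ => ?_⟩
  have hpoint := eq_of_joined_of_isCoveringMap cov ((hc i x hxi).symm.trans (hc j x hxj)) rfl
  have hx : x ∈ W (Z.indexAt x) := Z.mem_baseSet_at x
  have hcoord : c i * φ i (Z.indexAt x) = c j * φ j (Z.indexAt x) :=
    eq_of_heq (Bundle.TotalSpace.mk.inj hpoint).2
  rw [← hφ ⟨x, ⟨hxi, hxj⟩, hx⟩, ← mul_assoc] at hcoord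
  exact mul_right_cancel hcoord

theorem eq_of_forall_overlap_eq {S : Type*} [PreconnectedSpace B] (hWo : ∀ i, IsOpen (W i))
    (hWc : ∀ x, ∃ i, x ∈ W i) {f : ι → S} (hf : ∀ i j, (W i ∩ W j).Nonempty → f i = f j)
    {i j : ι} (hi : (W i).Nonempty) (hj : (W j).Nonempty) : f i = f j := by
  choose k hk using hWc
  have hloc : IsLocallyConstant fun x => f (k x) :=
    (IsLocallyConstant.iff_exists_open _).mpr fun x =>
      ⟨W (k x), hWo _, hk x, fun y hy => hf _ _ ⟨y, hk y, hy⟩⟩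
  obtain ⟨x, hx⟩ := hi
  obtain ⟨y, hy⟩ := hj
  calc f i = f (k x) := hf _ _ ⟨x, hx, hk x⟩
    _ = f (k y) := hloc.apply_eq_of_preconnectedSpace x y
    _ = f j := hf _ _ ⟨y, hk y, hy⟩

theorem IsFlatTrivialization.mul_inv_eq [PreconnectedSpace B] {c c' : ι → T}
    (hc : IsFlatTrivialization W φ c) (hc' : IsFlatTrivialization W φ c')
    (hWo : ∀ i, IsOpen (W i)) (hWc : ∀ x, ∃ i, x ∈ W i) {i j : ι} (hi : (W i).Nonempty)
    (hj : (W j).Nonempty) : c' i * (c i)⁻¹ = c' j * (c j)⁻¹ := by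
  refine eq_of_forall_overlap_eq (f := fun i => c' i * (c i)⁻¹) hWo hWc (fun i j hij => ?_) hi hj
  rw [← hc hij, ← hc' hij]
  group

end Cocycle

section Macbeath

variable {G M K : Type*} [Group G] [MulAction G M] [Group K] {V : Set M}

theorem IsGCovering.exists_mem_smul (hVc : IsGCovering G V) (x : M) : ∃ g : G, x ∈ g • V :=
  Set.mem_iUnion.mp (hVc ▸ Set.mem_univ x)

theorem inter_inv_mul_smul_nonempty {g h : G} (hne : (g • V ∩ h • V).Nonempty) :
    (V ∩ (g⁻¹ * h) • V).Nonempty := by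
  simpa [Set.smul_set_inter, smul_smul] using hne.smul_set (a := g⁻¹)

theorem isFlatCocycle_smul {φ : G → K}
    (hφ : ∀ g h : G, (V ∩ g • V ∩ (g * h) • V).Nonempty → φ g * φ h = φ (g * h)) :
    IsFlatCocycle (fun g : G => g • V) fun g h => φ (g⁻¹ * h) := by
  intro i j k hijk
  have hcancel : i⁻¹ * j * (j⁻¹ * k) = i⁻¹ * k := by group
  have hne : (V ∩ (i⁻¹ * j) • V ∩ (i⁻¹ * k) • V).Nonempty := by
    simpa [Set.smul_set_inter, smul_smul] using hijk.smul_set (a := i⁻¹)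
  rw [hφ _ _ (hcancel ▸ hne), hcancel]

theorem IsFlatTrivialization.comp_mul_left {φ c : G → K}
    (hc : IsFlatTrivialization (fun g : G => g • V) (fun g h => φ (g⁻¹ * h)) c) (k : G) :
    IsFlatTrivialization (fun g : G => g • V) (fun g h => φ (g⁻¹ * h)) fun g => c (k * g) := by
  intro i j hij
  have hne : ((k * i) • V ∩ (k * j) • V).Nonempty := by
    simpa [Set.smul_set_inter, smul_smul] using hij.smul_set (a := k)
  simpa [mul_assoc] using hc hne

theorem isFlatTrivialization_monoidHom {φ : G → K} {ψ : G →* K}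
    (hψ : ∀ g : G, (V ∩ g • V).Nonempty → ψ g = φ g) :
    IsFlatTrivialization (fun g : G => g • V) (fun g h => φ (g⁻¹ * h)) ψ := by
  intro i j hij
  change ψ i * φ (i⁻¹ * j) = ψ j
  rw [← hψ _ (inter_inv_mul_smul_nonempty hij), ← map_mul, mul_inv_cancel_left]

variable [TopologicalSpace M] [ContinuousConstSMul G M]

theorem IsGCovering.monoidHom_ext [PreconnectedSpace M] (hVc : IsGCovering G V)
    (hVo : IsOpen V) (hV : V.Nonempty) {ψ ψ' : G →* K}
    (h : ∀ g : G, (V ∩ g • V).Nonempty → ψ g = ψ' g) : ψ = ψ' := by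
  ext g
  have hconst := (isFlatTrivialization_monoidHom h).mul_inv_eq
    (isFlatTrivialization_monoidHom fun _ _ => rfl) (fun g => hVo.smul g) hVc.exists_mem_smul
    (i := g) (j := 1) hV.smul_set hV.smul_set
  rw [map_one, map_one, inv_one, mul_one, mul_inv_eq_one] at hconst
  exact hconst.symm

/-- **Macbeath's theorem**, that `G` is generated by the `g` with `V ∩ gV ≠ ∅` subject to the
relations visible on triple overlaps, phrased as extension of local homomorphisms. -/
theorem IsGCovering.exists_monoidHom [SimplyConnectedSpace M] (hVc : IsGCovering G V)
    (hVo : IsOpen V) (hVp : IsPathConnected V) {φ : G → K}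
    (hφ : ∀ g h : G, (V ∩ g • V ∩ (g * h) • V).Nonempty → φ g * φ h = φ (g * h)) :
    ∃ ψ : G →* K, ∀ g : G, (V ∩ g • V).Nonempty → ψ g = φ g := by
  obtain ⟨c, hc⟩ := (isFlatCocycle_smul hφ).exists_isFlatTrivialization (fun g => hVo.smul g)
    (fun g => hVp.image (continuous_const_smul g)) hVc.exists_mem_smul
  have hmul (g h : G) : c (g * h) * (c h)⁻¹ = c g * (c 1)⁻¹ := by
    simpa using hc.mul_inv_eq (hc.comp_mul_left g) (fun g => hVo.smul g) hVc.exists_mem_smul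
      (i := h) (j := 1) hVp.nonempty.smul_set hVp.nonempty.smul_set
  refine ⟨MonoidHom.mk' (fun g => (c 1)⁻¹ * c g) fun g h => ?_, fun g hg => ?_⟩
  · rw [mul_inv_eq_iff_eq_mul.mp (hmul g h)]
    group
  · have hcg : c 1 * φ (1⁻¹ * g) = c g := hc (by simpa using hg)
    rw [MonoidHom.mk'_apply, ← hcg, inv_one, one_mul, inv_mul_cancel_left]

end Macbeath

section DivMultiplicative

/-- A partial homomorphism on the quotients of elements of `Y`: a total function `σ`, with no
condition outside `Y / Y`, which respects the products `(a / b) * (b / c)`. -/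
def IsDivMultiplicativeOn {G K : Type*} [Group G] [Group K] (σ : G → K) (Y : Set G) : Prop :=
  ∀ ⦃a⦄, a ∈ Y → ∀ ⦃b⦄, b ∈ Y → ∀ ⦃c⦄, c ∈ Y → σ (a / b) * σ (b / c) = σ (a / c)

theorem IsDivMultiplicativeOn.mono {G K : Type*} [Group G] [Group K] {σ : G → K} {Y Y' : Set G}
    (hσ : IsDivMultiplicativeOn σ Y') (h : Y ⊆ Y') : IsDivMultiplicativeOn σ Y :=
  fun _ ha _ hb _ hc => hσ (h ha) (h hb) (h hc)

theorem IsDivMultiplicativeOn.eqOn_div {G K : Type*} [Group G] [Group K] {σ : G → K} {Y : Set G}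
    (hσ : IsDivMultiplicativeOn σ Y) (h1 : (1 : G) ∈ Y) {ψ : G →* K} (hψ : Set.EqOn ψ σ Y) :
    Set.EqOn ψ σ (Y / Y) := by
  rintro _ ⟨s, hs, t, ht, rfl⟩
  have hst : σ (s / t) * ψ t = ψ s := by
    simpa only [div_one, ← hψ hs, ← hψ ht] using hσ hs ht h1
  rw [map_div, div_eq_iff_eq_mul, hst]

variable {H K : Type*} [TopologicalSpace H] [Group H] [Group K] {G : Subgroup H}
  [ContinuousConstSMul G H] {V X : Set H}

theorem mem_div_of_inter_smul_nonempty (hG : Dense (G : Set H)) (hVo : IsOpen V) {g : G}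
    (hne : (V ∩ g • V).Nonempty) : g ∈ ((↑) ⁻¹' V / (↑) ⁻¹' V : Set G) := by
  obtain ⟨a, haV, hag⟩ := hG.denseRange_val.exists_mem_open (hVo.inter (hVo.smul g)) hne
  exact ⟨a, haV, g⁻¹ * a, Set.mem_smul_set_iff_inv_smul_mem.mp hag, by simp⟩

theorem IsDivMultiplicativeOn.map_mul_of_inter_nonempty {σ : G → K}
    (hσ : IsDivMultiplicativeOn σ ((↑) ⁻¹' V)) (hG : Dense (G : Set H)) (hVo : IsOpen V) (g h : G)
    (hne : (V ∩ g • V ∩ (g * h) • V).Nonempty) : σ g * σ h = σ (g * h) := by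
  obtain ⟨a, ⟨haV, hag⟩, hagh⟩ := hG.denseRange_val.exists_mem_open
    ((hVo.inter (hVo.smul g)).inter (hVo.smul (g * h))) hne
  have hmul := hσ (a := a) haV (b := g⁻¹ * a) (Set.mem_smul_set_iff_inv_smul_mem.mp hag)
    (c := (g * h)⁻¹ * a) (Set.mem_smul_set_iff_inv_smul_mem.mp hagh)
  simpa [div_eq_mul_inv, mul_assoc] using hmul

theorem IsDivMultiplicativeOn.exists_monoidHom_eqOn [SimplyConnectedSpace H] {σ : G → K}
    (hσ : IsDivMultiplicativeOn σ ((↑) ⁻¹' X)) (hG : Dense (G : Set H)) (h1 : (1 : H) ∈ X)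
    (hVX : V ⊆ X) (hVo : IsOpen V) (hVp : IsPathConnected V) (hVc : IsGCovering G V)
    (hX : X ⊆ V / V) : ∃ ψ : G →* K, Set.EqOn ψ σ ((↑) ⁻¹' X / (↑) ⁻¹' X) := by
  obtain ⟨ψ, hψ⟩ := hVc.exists_monoidHom hVo hVp
    ((hσ.mono (Set.preimage_mono hVX)).map_mul_of_inter_nonempty hG hVo)
  refine ⟨ψ, hσ.eqOn_div h1 fun s hs => hψ s ?_⟩
  obtain ⟨v, hv, w, hw, hvw⟩ := hX hs
  exact ⟨v, hv, w, hw, div_eq_iff_eq_mul.mp hvw |>.symm⟩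

end DivMultiplicative

theorem UniversalGroup.of_mul_of {S : Type*} [PartialMul S] {s t u : S}
    (h : PartialMul.IsMul s t u) :
    (PresentedGroup.of s * PresentedGroup.of t : UniversalGroup S) = PresentedGroup.of u :=
  PresentedGroup.mk_eq_mk_of_mul_inv_mem ⟨s, t, u, h, rfl⟩

namespace GammaSemigroup

variable {H : Type*} [Group H] {X : Set H} {G : Subgroup H}

theorem one_mem_of_mem_patterns {P : Set H} (hP : P ∈ patterns X G) : (1 : H) ∈ P := by
  obtain ⟨F, -, -, hF, rfl⟩ := hP
  exact fun A hA => (hF hA).2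

theorem smul_mem_patterns {a : G} (h : (1 : H) ∈ a • X) : a • X ∈ patterns X G :=
  ⟨{a • X}, Set.finite_singleton _, Set.singleton_nonempty _,
    Set.singleton_subset_iff.mpr ⟨⟨a, rfl⟩, h⟩, (Set.sInter_singleton _).symm⟩

theorem one_mem_smul_iff {a : G} : (1 : H) ∈ a • X ↔ a⁻¹ ∈ ((↑) ⁻¹' X : Set G) := by
  rw [Set.mem_smul_set_iff_inv_smul_mem, Subgroup.smul_def, smul_eq_mul, mul_one]
  rfl

namespace Triple

theorem inv_left_mem (x : Triple X G) : x.left⁻¹ ∈ ((↑) ⁻¹' X : Set G) :=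
  one_mem_smul_iff.mp (x.subset_left (one_mem_of_mem_patterns x.mem_patterns))

theorem inv_right_mem (x : Triple X G) : x.right⁻¹ ∈ ((↑) ⁻¹' X : Set G) :=
  one_mem_smul_iff.mp (x.subset_right (one_mem_of_mem_patterns x.mem_patterns))

/-- The triple `(a⁻¹, a⁻¹X ∩ b⁻¹X, b⁻¹)`, the largest one with these end points. -/
def full {a b : G} (ha : a ∈ ((↑) ⁻¹' X : Set G)) (hb : b ∈ ((↑) ⁻¹' X : Set G)) :
    Triple X G where
  left := a⁻¹
  pattern := a⁻¹ • X ∩ b⁻¹ • X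
  right := b⁻¹
  mem_patterns := inter_mem_patterns (smul_mem_patterns (one_mem_smul_iff.mpr (by rwa [inv_inv])))
    (smul_mem_patterns (one_mem_smul_iff.mpr (by rwa [inv_inv])))
  subset_left := Set.inter_subset_left
  subset_right := Set.inter_subset_right

/-- The element `a⁻¹b` attached to a triple `(a, P, b)`. -/
def ratio (x : Triple X G) : G := x.left⁻¹ * x.right

theorem ratio_full {a b : G} (ha : a ∈ ((↑) ⁻¹' X : Set G)) (hb : b ∈ ((↑) ⁻¹' X : Set G)) :
    (full ha hb).ratio = a / b := by
  simp [ratio, full, div_eq_mul_inv]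

theorem ratio_mem_div (x : Triple X G) : x.ratio ∈ ((↑) ⁻¹' X / (↑) ⁻¹' X : Set G) :=
  ⟨x.left⁻¹, x.inv_left_mem, x.right⁻¹, x.inv_right_mem, by simp [ratio]⟩

end Triple

end GammaSemigroup

namespace Gamma

open GammaSemigroup

variable {H : Type*} [Group H] {X : Set H} {G : Subgroup H}

/-- The class of a triple in the universal group of `Γ(X, G, H)`. -/
def toUniversal (x : Triple X G) : UniversalGroup (Gamma X G) := PresentedGroup.of (Gamma.mk x)

theorem toUniversal_mul (x y : Triple X G) (h : x.right = y.left) :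
    toUniversal (x.mul y h) = toUniversal x * toUniversal y :=
  Eq.symm <| UniversalGroup.of_mul_of ⟨x, y, h, rfl, rfl, rfl⟩

theorem toUniversal_act (g : G) (x : Triple X G) (h : g • x.pattern ∈ patterns X G) :
    toUniversal (x.act g h) = toUniversal x :=
  congrArg PresentedGroup.of
    (Quotient.sound (s := orbitSetoid X G) (a := x) (b := x.act g h) ⟨g, h, rfl⟩).symm

theorem toUniversal_eq_one {x : Triple X G} (h : x.right = x.left) : toUniversal x = 1 := by
  have hidem : x.mul x h = x := Triple.ext rfl (Set.inter_self _) rfl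
  simpa only [hidem, right_eq_mul] using toUniversal_mul x x h

theorem toUniversal_eq_of_subset {x y : Triple X G} (hl : x.left = y.left)
    (hr : x.right = y.right) (h : x.pattern ⊆ y.pattern) : toUniversal x = toUniversal y := by
  let e : Triple X G := ⟨x.left, x.pattern, x.left, x.mem_patterns, x.subset_left, x.subset_left⟩
  have hey : e.mul y hl = x := Triple.ext rfl (Set.inter_eq_left.mpr h) hr.symm
  rw [← hey, toUniversal_mul, toUniversal_eq_one (x := e) rfl, one_mul]

theorem toUniversal_eq_full (x : Triple X G) :
    toUniversal x = toUniversal (Triple.full x.inv_left_mem x.inv_right_mem) :=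
  toUniversal_eq_of_subset (inv_inv _).symm (inv_inv _).symm
    (by simpa only [Triple.full, inv_inv] using Set.subset_inter x.subset_left x.subset_right)

theorem toUniversal_eq_of_ratio_eq {x y : Triple X G} (h : x.ratio = y.ratio) :
    toUniversal x = toUniversal y := by
  rw [toUniversal_eq_full x, toUniversal_eq_full y]
  set z := Triple.full x.inv_left_mem x.inv_right_mem
  set w := Triple.full y.inv_left_mem y.inv_right_mem
  let g := y.left * x.left⁻¹
  have hl : g * z.left = w.left := by simp [g, z, w, Triple.full]
  have hr : g * z.right = w.right := by
    simpa [g, z, w, Triple.full, Triple.ratio, mul_assoc, eq_inv_mul_iff_mul_eq] using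
      congrArg (y.left * ·) h
  have hp : g • z.pattern = w.pattern := by
    change g • (z.left • X ∩ z.right • X) = w.left • X ∩ w.right • X
    rw [Set.smul_set_inter, smul_smul, smul_smul, hl, hr]
  rw [← toUniversal_act g z (hp ▸ w.mem_patterns)]
  exact congrArg toUniversal (Triple.ext hl hp hr)

/-- The element `a⁻¹b` attached to a class `[a, P, b]`. -/
def ratio : Gamma X G → G :=
  Quotient.lift Triple.ratio <| by
    rintro x _ ⟨g, h, rfl⟩
    simp [Triple.ratio, Triple.act, mul_assoc]

theorem ratio_mul {s t u : Gamma X G} (h : PartialMul.IsMul s t u) :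
    ratio s * ratio t = ratio u := by
  obtain ⟨x, y, hxy, rfl, rfl, rfl⟩ := h
  change x.left⁻¹ * x.right * (y.left⁻¹ * y.right) = x.left⁻¹ * y.right
  rw [hxy]
  group

/-- The canonical homomorphism from the universal group of `Γ(X, G, H)` to `G`, which takes
`[a, P, b]` to `a⁻¹b`. -/
def toSubgroup (X : Set H) (G : Subgroup H) : UniversalGroup (Gamma X G) →* G :=
  PresentedGroup.toGroup (f := ratio) <| by
    rintro _ ⟨s, t, u, h, rfl⟩
    simp [ratio_mul h]

theorem toSubgroup_toUniversal (x : Triple X G) :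
    toSubgroup X G (toUniversal x) = x.ratio :=
  PresentedGroup.toGroup.of _

/-- The map `a⁻¹b ↦ [a, P, b]` into the universal group, with value `1` where no triple
`(a, P, b)` exists. -/
noncomputable def localSection (X : Set H) (G : Subgroup H) : G → UniversalGroup (Gamma X G) :=
  Function.extend Triple.ratio toUniversal 1

theorem localSection_ratio (x : Triple X G) : localSection X G x.ratio = toUniversal x :=
  Function.FactorsThrough.extend_apply (fun _ _ => toUniversal_eq_of_ratio_eq) _ _

theorem localSection_div {a b : G} (ha : a ∈ ((↑) ⁻¹' X : Set G))
    (hb : b ∈ ((↑) ⁻¹' X : Set G)) :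
    localSection X G (a / b) = toUniversal (Triple.full ha hb) := by
  rw [← Triple.ratio_full ha hb, localSection_ratio]

theorem isDivMultiplicativeOn_localSection :
    IsDivMultiplicativeOn (localSection X G) ((↑) ⁻¹' X) := by
  intro a ha b hb c hc
  rw [localSection_div ha hb, localSection_div hb hc, localSection_div ha hc,
    ← toUniversal_mul _ _ rfl]
  exact toUniversal_eq_of_subset rfl rfl
    (Set.inter_subset_inter Set.inter_subset_left Set.inter_subset_right)

theorem toSubgroup_localSection {g : G} (hg : g ∈ ((↑) ⁻¹' X / (↑) ⁻¹' X : Set G)) :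
    toSubgroup X G (localSection X G g) = g := by
  obtain ⟨a, ha, b, hb, rfl⟩ := hg
  rw [localSection_div ha hb, toSubgroup_toUniversal, Triple.ratio_full]

end Gamma

open Gamma in
theorem theorem2p4p7_general {H : Type*} [TopologicalSpace H] [Group H] [SimplyConnectedSpace H]
    (G : Subgroup H) [ContinuousConstSMul G H] (hG : Dense (G : Set H)) (V X : Set H)
    (h1 : (1 : H) ∈ X) (hVX : V ⊆ X) (hVo : IsOpen V) (hVp : IsPathConnected V)
    (hVc : IsGCovering G V) (hX : X ⊆ ⋃ s ∈ V, (fun v => v * s⁻¹) '' V) :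
    Function.Bijective (toSubgroup X G) := by
  simp only [← div_eq_mul_inv, Set.iUnion_div_right_image] at hX
  obtain ⟨ψ, hψ⟩ :=
    isDivMultiplicativeOn_localSection.exists_monoidHom_eqOn hG h1 hVX hVo hVp hVc hX
  have hleft : ψ.comp (toSubgroup X G) = MonoidHom.id _ := PresentedGroup.ext fun s => by
    obtain ⟨x, rfl⟩ := Quotient.exists_rep s
    change ψ (toSubgroup X G (toUniversal x)) = toUniversal x
    rw [toSubgroup_toUniversal, hψ x.ratio_mem_div, localSection_ratio]
  have hright : (toSubgroup X G).comp ψ = MonoidHom.id G :=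
    hVc.monoidHom_ext hVo hVp.nonempty fun g hg => by
      have hgX := Set.div_subset_div (Set.preimage_mono hVX) (Set.preimage_mono hVX)
        (mem_div_of_inter_smul_nonempty hG hVo hg)
      rw [MonoidHom.comp_apply, hψ hgX, toSubgroup_localSection hgX, MonoidHom.id_apply]
  exact Function.bijective_iff_has_inverse.mpr ⟨ψ, DFunLike.congr_fun hleft,
    DFunLike.congr_fun hright⟩

theorem theorem2p4p7 {H : Type*} [TopologicalSpace H] [Group H] [IsTopologicalGroup H]
    [SimplyConnectedSpace H] (G : Subgroup H) (hG : Dense (G : Set H)) (V X : Set H)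
    (h1 : (1 : H) ∈ V) (hVX : V ⊆ X) (hVo : IsOpen V) (hVp : IsPathConnected V)
    (hVc : IsGCovering G V) (hX : X ⊆ ⋃ s ∈ V, (fun v => v * s⁻¹) '' V) :
    Nonempty (UniversalGroup (Gamma X G) ≃* G) :=
  ⟨MulEquiv.ofBijective _ (theorem2p4p7_general G hG V X (hVX h1) hVX hVo hVp hVc hX)⟩
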